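/- Let $G=G(\{A_i\}_{i=1}^n,\{u_i\}_{i=1}^n)$ be a finite normal-form game with nonempty finite action sets $A_i$ and utilities $u_i:A\to\mathbb R$, $A=\prod_i A_i$. Let $d_i=|A_{-i}|$, where $A_{-i}=\prod_{j\neq i}A_j$, and let $\boldsymbol u_i(a_i,\cdot)\in\mathbb R^{d_i}$ be the vector $(u_i(a_i,a_{-i}))_{a_{-i}\in A_{-i}}$. For a distribution $\boldsymbol x\in\Delta(A)$ put $\boldsymbol x(a_i,\cdot)=(\boldsymbol x(a_i,a_{-i}))_{a_{-i}}$. A game $G'$ with the same action sets and utilities $v_i$ is *indistinguishable from $G$ under best-response feedback* if for all $\boldsymbol x\in\Delta(A)$, all $i$ and all $a_i\in A_i$, $$\arg\max_{a_i'\in A_i}\langle \boldsymbol x(a_i,\cdot),\boldsymbol u_i(a_i',\cdot)\rangle=\arg\max_{a_i'\in A_i}\langle \boldsymbol x(a_i,\cdot),\boldsymbol v_i(a_i',\cdot)\rangle .$$ An action $a_i$ is *dominated* if there is a probability distribution $s$ on $A_i\setminus\{a_i\}$ with $u_i(a_i,a_{-i})\le\sum_{a_i'}s(a_i')\,u_i(a_i',a_{-i})$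 for all $a_{-i}\in A_{-i}$. Assume that $G$ has no dominated actions, and let $\mathcal U^{BR}(G)$ be the set of games without dominated actions that are indistinguishable from $G$ under best-response feedback. For a polyhedron $P\subseteq\mathbb R^d$ and a nonempty face $F$ of $P$ let $\mathcal N_P(F)=\{y\in\mathbb R^d:\langle y,x\rangle\ge\langle y,x'\rangle\ \forall x\in F,\ x'\in P\}$, and let $\mathcal N(P)=\{\mathcal N_P(F): F\text{ a nonempty face of }P\}$ be the normal fan of $P$. Let $\mathcal P_i=\operatorname{conv}\{\boldsymbol u_i(a_i,\cdot):a_i\in A_i\}$, $C_i=\mathbb R^{d_i}_+$, $C_i^\circ$ its polar cone, and $\tilde{\mathcal P}_i=\mathcal P_i+C_i^\circ$ (Minkowski sum). Then: 1. $$\mathcal U^{BR}(G)=\Bigl\{G'\bigl(\{A_i\}_{i=1}^n,\{\sigma(\operatorname{ext}(Q_i))\}_{i=1}^n\bigr)\ \Big|\ Q_i\subseteq\mathbb R^{d_i}\text{ a polyhedron},\ \mathcal N(Q_i)=\mathcal N(\tilde{\mathcal P}_i)\ \ \forall i\in[n]\Bigr\},$$ where $\sigma(\operatorname{ext}(Q_i))$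 denotes the utility vectors $\boldsymbol v_i(a_i,\cdot)$, $a_i\in A_i$, that enumerate the extreme points of $Q_i$, each exactly once, with labels that correspond to those of $\mathcal P_i$: $\mathcal N_{Q_i}(\{\boldsymbol v_i(a_i,\cdot)\})=\mathcal N_{\tilde{\mathcal P}_i}(\{\boldsymbol u_i(a_i,\cdot)\})$ for all $a_i\in A_i$. 2. For all polyhedra $Q_1,\dots,Q_n$ with $\mathcal N(Q_i)=\mathcal N(\tilde{\mathcal P}_i)$ for every $i$, this labeling exists and is unique. 3. Every game that is indistinguishable from $G$ under best-response feedback has no dominated actions, so $\mathcal U^{BR}(G)$ is the set of all games indistinguishable from $G$ under best-response feedback. -/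

import Mathlib

open scoped Pointwise

namespace NormalFormGame

universe w

variable {n : ℕ} {A : Fin n → Type w}

/-- Profiles `a_{-i}` of actions of all agents except `i`. -/
abbrev Opp (A : Fin n → Type w) (i : Fin n) : Type w :=
  ∀ j : {j : Fin n // j ≠ i}, A j

/-- The utility functions `u_i : A → ℝ` of a game with action sets `A_1, …, A_n`. -/
abbrev Utilities (A : Fin n → Type w) : Type w :=
  Fin n → (∀ j, A j) → ℝ

/-- The full action profile `(a_i, a_{-i})`. -/
def profile (i : Fin n) (a : A i) (b : Opp A i) : ∀ j, A j :=
  (Equiv.piSplitAt i A).symm (a, b)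

/-- The slice `f(a_i, ·)` of a function on action profiles, a vector indexed by `A_{-i}`. -/
def slice (f : (∀ j, A j) → ℝ) (i : Fin n) (a : A i) : Opp A i → ℝ :=
  fun b => f (profile i a b)

/-- The utility vector `u_i(a_i, ·)`. -/
def utilityVector (u : Utilities A) (i : Fin n) (a : A i) : Opp A i → ℝ :=
  slice (u i) i a

section Finite

variable [∀ i, Fintype (A i)]

/-- The best responses of agent `i` to the recommendation `a` under the mechanism `x`: the
maximizers `a'` of `⟨x(a, ·), u_i(a', ·)⟩`. -/
def bestResponse (u : Utilities A) (x : (∀ j, A j) → ℝ) (i : Fin n) (a : A i) : Set (A i) :=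
  {a' | ∀ a'' : A i,
    slice x i a ⬝ᵥ utilityVector u i a'' ≤ slice x i a ⬝ᵥ utilityVector u i a'}

/-- Two games have the same best-response feedback under every joint distribution of
recommendations. -/
def BRIndistinguishable (u v : Utilities A) : Prop :=
  ∀ x ∈ stdSimplex ℝ (∀ j, A j), ∀ (i : Fin n) (a : A i),
    bestResponse u x i a = bestResponse v x i a

/-- A mixture `s` of the actions of agent `i` other than `a` pays at least as much as `a` against
every profile of the opponents. -/
def IsDominated (u : Utilities A) (i : Fin n) (a : A i) : Prop :=
  ∃ s ∈ stdSimplex ℝ (A i), s a = 0 ∧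
    ∀ b : Opp A i, utilityVector u i a b ≤ ∑ a' : A i, s a' * utilityVector u i a' b

def NoDominatedActions (u : Utilities A) : Prop :=
  ∀ (i : Fin n) (a : A i), ¬ IsDominated u i a

/-- The games without dominated actions that are indistinguishable from `u` under best-response
feedback. -/
def brIndistinguishabilitySet (u : Utilities A) : Set (Utilities A) :=
  {v | NoDominatedActions v ∧ BRIndistinguishable u v}

end Finite

section Polyhedra

variable {ι : Type w} [Fintype ι]

/-- A finite intersection of closed half-spaces. -/
def IsPolyhedron (P : Set (ι → ℝ)) : Prop :=
  ∃ (m : ℕ) (c : Fin m → ι → ℝ) (h : Fin m → ℝ), P = {y | ∀ k, c k ⬝ᵥ y ≤ h k}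

/-- The normal cone of `F` with respect to `P`. -/
def normalCone (P F : Set (ι → ℝ)) : Set (ι → ℝ) :=
  {y | ∀ x ∈ F, ∀ x' ∈ P, y ⬝ᵥ x' ≤ y ⬝ᵥ x}

/-- The normal cones of all nonempty faces. The nonempty faces of a polyhedron are its nonempty
exposed subsets, the polyhedron itself included. -/
def normalFan (P : Set (ι → ℝ)) : Set (Set (ι → ℝ)) :=
  {N | ∃ F : Set (ι → ℝ), IsExposed ℝ P F ∧ F.Nonempty ∧ N = normalCone P F}

/-- The polar cone `C°`. -/
def polarCone (C : Set (ι → ℝ)) : Set (ι → ℝ) :=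
  {k | ∀ y ∈ C, y ⬝ᵥ k ≤ 0}

/-- The orthant of vectors with nonnegative entries. -/
def orthant (ι : Type w) : Set (ι → ℝ) :=
  {y | ∀ k, 0 ≤ y k}

end Polyhedra

/-- The convex hull of the utility vectors of agent `i`. -/
def utilityPolytope (u : Utilities A) (i : Fin n) : Set (Opp A i → ℝ) :=
  convexHull ℝ (Set.range (utilityVector u i))

variable [∀ i, Fintype (A i)]

/-- The polarized polyhedron: the Minkowski sum of the utility polytope and the polar cone of the
orthant. -/
def polarizedPolyhedron (u : Utilities A) (i : Fin n) : Set (Opp A i → ℝ) :=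
  utilityPolytope u i + polarCone (orthant (Opp A i))

/-- Every `Q_i` is a polyhedron with the same normal fan as the polarized polyhedron of agent
`i`. -/
def NormallyEquivalent (u : Utilities A) (Q : ∀ i, Set (Opp A i → ℝ)) : Prop :=
  ∀ i, IsPolyhedron (Q i) ∧ normalFan (Q i) = normalFan (polarizedPolyhedron u i)

/-- For each agent `i`, the utility vectors of `v` are the extreme points of `Q_i`, each listed
once, and the extreme point with label `a` corresponds to the utility vector of `u` with label `a`:
the two have the same normal cone. -/
def IsLabeledExtremePoints (u : Utilities A) (Q : ∀ i, Set (Opp A i → ℝ))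
    (v : Utilities A) : Prop :=
  ∀ i, Set.BijOn (utilityVector v i) Set.univ ((Q i).extremePoints ℝ) ∧
    ∀ a : A i, normalCone (Q i) {utilityVector v i a} =
      normalCone (polarizedPolyhedron u i) {utilityVector u i a}

end NormalFormGame

/-! Every nonzero nonnegative vector is a positive multiple of a slice of some distribution, and at
the zero vector all actions maximize. Hence indistinguishability means that `u` and `v` have the
same `maximizers` at every point of the orthant (`brIndistinguishable_iff`). The polarized
polyhedron is the downward closure of the utility polytope (`lowerHull`). A functional is bounded
above on it only if it is nonnegative, so the normal cone at the utility vector of `a` is the region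
of the orthant where `a` is a best response, and the whole fan is determined by the maximizers
(`normalFan_lowerHull`). Thus `lowerHull` of `v` serves as `Q_i`; conversely, equal labeled cones
give equal best responses. Labels rest on linear duality: an undominated action is the unique best
response to some strictly positive vector (`exists_pos_lt`). Its normal cone therefore has interior,
which forces any face with that cone to be a point (`exists_labeling`). The same certificate passes
to every indistinguishable game and rules out dominated actions there. -/

namespace NormalFormGame

universe w

/-! ### Fourier–Motzkin elimination -/

section Elimination

variable {E α : Type*} [AddCommGroup E] [Module ℝ E]

/-- Fourier–Motzkin elimination of one nonnegative variable from a homogeneous system. -/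
theorem exists_elimination (T : Finset (Module.Dual ℝ E)) (g : E) :
    ∃ T' : Finset (Module.Dual ℝ E), ∀ y,
      (∃ t : ℝ, 0 ≤ t ∧ ∀ c ∈ T, c (y - t • g) ≤ 0) ↔ ∀ c ∈ T', c y ≤ 0 := by
  classical
  -- Each pair `p g > 0 > q g` bounds `t` below and above; the positive combination that vanishes on
  -- `g` says that the bounds are compatible.
  refine ⟨T.filter (fun c => c g ≤ 0) ∪
    Finset.image₂ (fun p q => p g • q - q g • p) (T.filter fun c => 0 < c g)
      (T.filter fun c => c g < 0), fun y => ⟨?_, fun h => ?_⟩⟩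
  · rintro ⟨t, ht, h⟩ c hc
    simp only [map_sub, map_smul, smul_eq_mul] at h
    simp only [Finset.mem_union, Finset.mem_filter, Finset.mem_image₂] at hc
    rcases hc with ⟨hc, hcg⟩ | ⟨p, ⟨hp, hpg⟩, q, ⟨hq, hqg⟩, rfl⟩
    · nlinarith [h c hc]
    · simp only [LinearMap.sub_apply, LinearMap.smul_apply, smul_eq_mul]
      nlinarith [h p hp, h q hq]
  · simp only [Finset.mem_union, Finset.mem_filter, Finset.mem_image₂] at h
    -- The least admissible `t`: the largest of its lower bounds, 0 included.
    obtain ⟨t, htmem, ht⟩ := (insert 0 ((T.filter fun c => 0 < c g).image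
      fun c => c y / c g)).exists_max_image id ⟨0, by simp⟩
    simp only [Finset.mem_insert, Finset.mem_image, Finset.mem_filter, id, forall_eq_or_imp]
      at htmem ht
    refine ⟨t, ht.1, fun c hc => ?_⟩
    simp only [map_sub, map_smul, smul_eq_mul]
    rcases lt_trichotomy (c g) 0 with hcg | hcg | hcg
    · rcases htmem with rfl | ⟨p, ⟨hp, hpg⟩, rfl⟩
      · simpa using h c (Or.inl ⟨hc, hcg.le⟩)
      · have := h _ (Or.inr ⟨p, ⟨hp, hpg⟩, c, ⟨hc, hcg⟩, rfl⟩)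
        simp only [LinearMap.sub_apply, LinearMap.smul_apply, smul_eq_mul] at this
        have h2 : c y - p y / p g * c g = (p g * c y - c g * p y) / p g := by
          field_simp
        rw [h2]
        exact div_nonpos_of_nonpos_of_nonneg this hpg.le
    · simpa [hcg] using h c (Or.inl ⟨hc, hcg.le⟩)
    · have := ht.2 _ ⟨c, ⟨hc, hcg⟩, rfl⟩
      rw [div_le_iff₀ hcg] at this
      linarith

/-- Adding finitely many generators to a polyhedral cone gives a polyhedral cone. -/
theorem exists_elimination_finset (T : Finset (Module.Dual ℝ E)) (g : α → E) (s : Finset α) :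
    ∃ T' : Finset (Module.Dual ℝ E), ∀ y,
      (∃ r : α → ℝ, (∀ a, 0 ≤ r a) ∧ ∀ c ∈ T, c (y - ∑ a ∈ s, r a • g a) ≤ 0) ↔
        ∀ c ∈ T', c y ≤ 0 := by
  classical
  induction s using Finset.induction_on with
  | empty => exact ⟨T, fun y => ⟨fun ⟨_, _, h⟩ => by simpa using h,
      fun h => ⟨0, by simp, by simpa using h⟩⟩⟩
  | insert a s ha ih =>
    obtain ⟨T₁, h₁⟩ := ih
    obtain ⟨T₂, h₂⟩ := exists_elimination T₁ (g a)
    refine ⟨T₂, fun y => ?_⟩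
    rw [← h₂]
    simp only [← h₁]
    constructor
    · rintro ⟨r, hr, h⟩
      refine ⟨r a, hr a, r, hr, fun c hc => ?_⟩
      simpa [Finset.sum_insert ha, sub_sub] using h c hc
    · rintro ⟨t, ht, r, hr, h⟩
      refine ⟨Function.update r a t, fun b => ?_, fun c hc => ?_⟩
      · by_cases hb : b = a
        · subst hb; simpa using ht
        · simpa [hb] using hr b
      · have hs : ∑ x ∈ s, Function.update r a t x • g x = ∑ x ∈ s, r x • g x :=
          Finset.sum_congr rfl fun x hx => by
            rw [Function.update_of_ne (fun hxa : x = a => ha (hxa ▸ hx))]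
        rw [Finset.sum_insert ha, hs, Function.update_self, ← sub_sub]
        exact h c hc

end Elimination

/-! ### Downward closure of a polytope -/

section LowerHull

variable {α : Type*} {ι : Type w} [Fintype α]

/-- The vectors bounded above by some convex combination of the `f a`. -/
def lowerHull (f : α → ι → ℝ) : Set (ι → ℝ) :=
  {z | ∃ s ∈ stdSimplex ℝ α, ∀ b, z b ≤ ∑ a, s a * f a b}

theorem mem_lowerHull_of_le {f : α → ι → ℝ} {z z' : ι → ℝ} (hz : z ∈ lowerHull f)
    (h : ∀ b, z' b ≤ z b) : z' ∈ lowerHull f := by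
  obtain ⟨s, hs, hz⟩ := hz
  exact ⟨s, hs, fun b => (h b).trans (hz b)⟩

theorem apply_mem_lowerHull (f : α → ι → ℝ) (a : α) : f a ∈ lowerHull f := by
  classical
  refine ⟨Pi.single a 1, single_mem_stdSimplex ℝ a, fun b => ?_⟩
  simp [Pi.single_apply]

variable [Fintype ι]

/-- Homogenization: `z` belongs to the hull iff `(z, 1)` minus a nonnegative combination of the `(f
a, 1)` has nonpositive first part and last coordinate 0. Eliminate the weights, then restrict to
height 1. -/
theorem isPolyhedron_lowerHull (f : α → ι → ℝ) : IsPolyhedron (lowerHull f) := by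
  classical
  obtain ⟨T, hT⟩ := exists_elimination_finset (E := (ι → ℝ) × ℝ)
    (Finset.univ.image (fun b => (LinearMap.proj b : (ι → ℝ) →ₗ[ℝ] ℝ) ∘ₗ LinearMap.fst ℝ _ ℝ) ∪
      {LinearMap.snd ℝ _ ℝ, -LinearMap.snd ℝ _ ℝ}) (fun a => (f a, (1 : ℝ))) Finset.univ
  let c (k : Fin T.card) : Module.Dual ℝ ((ι → ℝ) × ℝ) := (T.equivFin.symm k : _)
  refine ⟨T.card, fun k b => c k (Pi.single b 1, 0), fun k => - c k (0, 1), ?_⟩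
  have key : ∀ k (z : ι → ℝ), c k (z, 1) =
      (fun b => c k (Pi.single b 1, 0)) ⬝ᵥ z + c k (0, 1) := by
    intro k z
    have h1 : c k (z, 1) = c k (z, 0) + c k (0, 1) := by rw [← map_add]; simp
    have h2 : (c k ∘ₗ LinearMap.inl ℝ (ι → ℝ) ℝ) z = ∑ b, z b * c k (Pi.single b 1, 0) := by
      rw [LinearMap.pi_apply_eq_sum_univ]
      simp [eq_comm]
      refine Finset.sum_congr rfl fun b _ => ?_
      congr 3
      ext j
      simp [Pi.single_apply, eq_comm]
    rw [h1]
    simp only [LinearMap.comp_apply, LinearMap.inl_apply] at h2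
    rw [h2, dotProduct]
    congr 1
    exact Finset.sum_congr rfl fun b _ => mul_comm _ _
  ext z
  have hz := hT (z, 1)
  have hR : (∀ c ∈ T, c (z, 1) ≤ 0) ↔
      ∀ k, (fun b => c k (Pi.single b 1, 0)) ⬝ᵥ z ≤ - c k (0, 1) := by
    constructor
    · intro h k
      have := h (c k) (T.equivFin.symm k).2
      rw [key] at this
      linarith
    · intro h d hd
      have h1 := h (T.equivFin ⟨d, hd⟩)
      have h2 := key (T.equivFin ⟨d, hd⟩) z
      have h3 : c (T.equivFin ⟨d, hd⟩) = d := by simp [c]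
      rw [h3] at h1 h2
      linarith
  refine Iff.trans ?_ (hz.trans hR)
  constructor
  · rintro ⟨s, hs, h⟩
    refine ⟨s, hs.1, fun d hd => ?_⟩
    simp only [Finset.mem_union, Finset.mem_image, Finset.mem_univ, true_and, Finset.mem_insert,
      Finset.mem_singleton] at hd
    have h1 := hs.2
    rcases hd with ⟨b, rfl⟩ | rfl | rfl
    · simpa [Prod.fst_sum, Finset.sum_apply] using h b
    · simp [Prod.snd_sum, h1]
    · simp [Prod.snd_sum, h1]
  · rintro ⟨r, hr, h⟩
    have h1 := h (LinearMap.snd ℝ _ ℝ) (by simp)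
    have h2 := h (-LinearMap.snd ℝ _ ℝ) (by simp)
    simp [Prod.snd_sum] at h1 h2
    refine ⟨r, ⟨hr, le_antisymm h2 h1⟩, fun b => ?_⟩
    have h3 := h ((LinearMap.proj b : (ι → ℝ) →ₗ[ℝ] ℝ) ∘ₗ LinearMap.fst ℝ _ ℝ) (by simp)
    simpa [Prod.fst_sum, Finset.sum_apply] using h3

end LowerHull

/-! ### Maximizers and domination -/

section Maximizers

variable {α : Type*} {ι : Type w} [Fintype ι]

/-- The indices `a` that maximize `⟨y, f a⟩`. -/
def maximizers (f : α → ι → ℝ) (y : ι → ℝ) : Set α :=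
  {a | ∀ a', y ⬝ᵥ f a' ≤ y ⬝ᵥ f a}

theorem maximizers_nonempty [Finite α] [Nonempty α] (f : α → ι → ℝ) (y : ι → ℝ) :
    (maximizers f y).Nonempty :=
  Finite.exists_max fun a => y ⬝ᵥ f a

theorem maximizers_smul (f : α → ι → ℝ) (y : ι → ℝ) {t : ℝ} (ht : 0 < t) :
    maximizers f (t • y) = maximizers f y := by
  ext a
  simp only [maximizers, Set.mem_ofPred_eq, smul_dotProduct, smul_eq_mul]
  exact forall_congr' fun _ => mul_le_mul_iff_right₀ ht

theorem maximizers_zero (f : α → ι → ℝ) : maximizers f 0 = Set.univ := by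
  ext a
  simp [maximizers]

variable [Fintype α]

/-- Some convex combination of the `f a'`, `a' ≠ a`, bounds `f a` from above. -/
def IsDominatedIndex (f : α → ι → ℝ) (a : α) : Prop :=
  ∃ s ∈ stdSimplex ℝ α, s a = 0 ∧ ∀ b, f a b ≤ ∑ a', s a' * f a' b

theorem dotProduct_sum_mul (y : ι → ℝ) (s : α → ℝ) (f : α → ι → ℝ) :
    (y ⬝ᵥ fun b => ∑ a, s a * f a b) = ∑ a, s a * (y ⬝ᵥ f a) := by
  simp only [dotProduct, Finset.mul_sum]
  rw [Finset.sum_comm]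
  exact Finset.sum_congr rfl fun a _ => Finset.sum_congr rfl fun b _ => by ring

theorem dotProduct_le_of_mem_lowerHull {f : α → ι → ℝ} {y z : ι → ℝ} {M : ℝ}
    (hy : y ∈ orthant ι) (hM : ∀ a, y ⬝ᵥ f a ≤ M) (hz : z ∈ lowerHull f) : y ⬝ᵥ z ≤ M := by
  obtain ⟨s, hs, hz⟩ := hz
  calc y ⬝ᵥ z ≤ y ⬝ᵥ fun b => ∑ a, s a * f a b :=
        Finset.sum_le_sum fun b _ => mul_le_mul_of_nonneg_left (hz b) (hy b)
    _ = ∑ a, s a * (y ⬝ᵥ f a) := dotProduct_sum_mul y s f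
    _ ≤ ∑ a, s a * M := Finset.sum_le_sum fun a _ => mul_le_mul_of_nonneg_left (hM a) (hs.1 a)
    _ = M := by rw [← Finset.sum_mul, hs.2, one_mul]

theorem mem_orthant_of_bounded {f : α → ι → ℝ} {y z : ι → ℝ} {M : ℝ} (hz : z ∈ lowerHull f)
    (hM : ∀ z ∈ lowerHull f, y ⬝ᵥ z ≤ M) : y ∈ orthant ι := by
  classical
  intro b
  by_contra hb
  push Not at hb
  have key : ∀ t : ℝ, 0 ≤ t → y ⬝ᵥ z - t * y b ≤ M := by
    intro t ht
    have := hM (z - t • Pi.single b 1) (mem_lowerHull_of_le hz fun j => by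
      by_cases h : j = b
      · subst h; simpa using ht
      · simp [h])
    simpa [dotProduct_sub, dotProduct_smul] using this
  -- Moving down this far along a coordinate where `y` is negative raises the value to `M + 1`.
  have h := key ((M - y ⬝ᵥ z + 1) / -y b) (div_nonneg
    (by linarith [hM z hz]) (by linarith))
  have h2 : (M - y ⬝ᵥ z + 1) / -y b * y b = -(M - y ⬝ᵥ z + 1) := by
    rw [div_neg, neg_mul, div_mul_cancel₀ _ hb.ne]
  linarith

theorem not_isDominatedIndex_of_lt {f : α → ι → ℝ} {a : α} {y : ι → ℝ} (hy : y ∈ orthant ι)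
    (h : ∀ a', a' ≠ a → y ⬝ᵥ f a' < y ⬝ᵥ f a) : ¬ IsDominatedIndex f a := by
  rintro ⟨s, hs, hsa, hle⟩
  have h1 : y ⬝ᵥ f a ≤ ∑ a', s a' * (y ⬝ᵥ f a') := by
    rw [← dotProduct_sum_mul]
    exact Finset.sum_le_sum fun b _ => mul_le_mul_of_nonneg_left (hle b) (hy b)
  have h2 : ∑ a', s a' * (y ⬝ᵥ f a') < ∑ a', s a' * (y ⬝ᵥ f a) := by
    obtain ⟨c, -, hc⟩ : ∃ c ∈ Finset.univ, s c ≠ 0 :=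
      Finset.exists_ne_zero_of_sum_ne_zero (by rw [hs.2]; exact one_ne_zero)
    have hca : c ≠ a := fun hca => hc (hca ▸ hsa)
    refine Finset.sum_lt_sum (fun a' _ => ?_) ⟨c, Finset.mem_univ c,
      mul_lt_mul_of_pos_left (h c hca) (lt_of_le_of_ne (hs.1 c) (Ne.symm hc))⟩
    by_cases ha : a' = a
    · rw [ha]
    · exact mul_le_mul_of_nonneg_left (h a' ha).le (hs.1 a')
  rw [← Finset.sum_mul, hs.2, one_mul] at h2
  linarith

/-- An undominated `f a` lies outside the lower hull of the other points, so it violates one of the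
defining inequalities; the normal of that inequality is bounded above on the hull, hence
nonnegative. -/
theorem exists_mem_orthant_lt {f : α → ι → ℝ} {a : α} (ha : ¬ IsDominatedIndex f a) :
    ∃ y ∈ orthant ι, ∀ a', a' ≠ a → y ⬝ᵥ f a' < y ⬝ᵥ f a := by
  classical
  rcases isEmpty_or_nonempty {a' // a' ≠ a} with hE | ⟨⟨a₀⟩⟩
  · exact ⟨0, fun _ => le_rfl, fun a' h => (hE.false ⟨a', h⟩).elim⟩
  let g : {a' // a' ≠ a} → ι → ℝ := fun a' => f a'
  have hnot : f a ∉ lowerHull g := by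
    rintro ⟨s, hs, hle⟩
    have hsum : ∀ F : α → ℝ, ∑ a', (if h : a' ≠ a then s ⟨a', h⟩ else 0) * F a' =
        ∑ a' : {a' // a' ≠ a}, s a' * F a' := by
      intro F
      rw [← Fintype.sum_subtype_add_sum_subtype (fun a' => a' ≠ a)]
      have h0 : ∑ a' : {a' // ¬ a' ≠ a},
          (if h : a'.1 ≠ a then s ⟨a'.1, h⟩ else 0) * F a' = 0 :=
        Finset.sum_eq_zero fun a' _ => by rw [dif_neg a'.2, zero_mul]
      rw [h0, add_zero]
      exact Finset.sum_congr rfl fun a' _ => by rw [dif_pos a'.2]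
    refine ha ⟨fun a' => if h : a' ≠ a then s ⟨a', h⟩ else 0, ⟨fun a' => ?_, ?_⟩, by simp,
      fun b => ?_⟩
    · dsimp only
      split_ifs with h
      exacts [hs.1 _, le_rfl]
    · simpa using (hsum fun _ => 1).trans (by simpa using hs.2)
    · rw [hsum fun a' => f a' b]
      exact hle b
  obtain ⟨m, c, h, hP⟩ := isPolyhedron_lowerHull g
  have hmem : ∀ z, z ∈ lowerHull g ↔ ∀ k, c k ⬝ᵥ z ≤ h k := fun z => by rw [hP]; rfl
  rw [hmem] at hnot
  push Not at hnot
  obtain ⟨k, hk⟩ := hnot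
  refine ⟨c k, mem_orthant_of_bounded (apply_mem_lowerHull g a₀)
    fun z hz => (hmem z).1 hz k, fun a' ha' => ?_⟩
  exact ((hmem _).1 (apply_mem_lowerHull g ⟨a', ha'⟩) k).trans_lt hk

theorem eventually_lt_of_lt {f : α → ι → ℝ} {a : α} {y : ι → ℝ}
    (h : ∀ a', a' ≠ a → y ⬝ᵥ f a' < y ⬝ᵥ f a) :
    ∀ᶠ z in nhds y, ∀ a', a' ≠ a → z ⬝ᵥ f a' < z ⬝ᵥ f a := by
  rw [Filter.eventually_all]
  intro a'
  by_cases ha : a' = a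
  · simp [ha]
  have hc : ∀ v : ι → ℝ, Continuous fun z : ι → ℝ => z ⬝ᵥ v := fun v =>
    continuous_finsetSum _ fun b _ => (continuous_apply b).mul continuous_const
  filter_upwards [(hc _).continuousAt.eventually_lt (hc _).continuousAt (h a' ha)] with z hz _
  exact hz

/-- The strict inequalities survive adding a small multiple of the all-ones vector. -/
theorem exists_pos_lt {f : α → ι → ℝ} {a : α} (ha : ¬ IsDominatedIndex f a) :
    ∃ y : ι → ℝ, (∀ b, 0 < y b) ∧ ∀ a', a' ≠ a → y ⬝ᵥ f a' < y ⬝ᵥ f a := by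
  obtain ⟨y, hy, h⟩ := exists_mem_orthant_lt ha
  have hlim : Filter.Tendsto (fun t : ℝ => y + t • (1 : ι → ℝ)) (nhdsWithin 0 (Set.Ioi 0))
      (nhds y) := by
    have : Continuous fun t : ℝ => y + t • (1 : ι → ℝ) := by fun_prop
    simpa using (this.tendsto 0).mono_left nhdsWithin_le_nhds
  obtain ⟨t, ht, htpos⟩ :=
    ((hlim.eventually (eventually_lt_of_lt h)).and self_mem_nhdsWithin).exists
  refine ⟨_, fun b => ?_, ht⟩
  have := hy b
  have htpos : 0 < t := htpos
  simp only [Pi.add_apply, Pi.smul_apply, Pi.one_apply, smul_eq_mul, mul_one]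
  linarith

end Maximizers

/-! ### Normal fan of the lower hull -/

section NormalFan

variable {α : Type*} {ι : Type w} [Fintype ι]

theorem isExposed_iff_dotProduct {P F : Set (ι → ℝ)} (hF : F.Nonempty) :
    IsExposed ℝ P F ↔ ∃ y : ι → ℝ, F = {x ∈ P | ∀ x' ∈ P, y ⬝ᵥ x' ≤ y ⬝ᵥ x} := by
  classical
  constructor
  · intro h
    obtain ⟨l, hl⟩ := h hF
    obtain ⟨y, hy⟩ : ∃ y : ι → ℝ, ∀ x, l x = y ⬝ᵥ x := by
      refine ⟨fun b => l (Pi.single b 1), fun x => ?_⟩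
      conv_lhs => rw [pi_eq_sum_univ' x]
      simp [dotProduct, mul_comm]
    exact ⟨y, by simpa only [hy] using hl⟩
  · rintro ⟨y, hy⟩ _
    exact ⟨LinearMap.toContinuousLinearMap (dotProductBilin ℝ ℝ y), hy⟩

variable [Fintype α]

theorem normalCone_lowerHull_singleton (f : α → ι → ℝ) (a : α) :
    normalCone (lowerHull f) {f a} = {z | z ∈ orthant ι ∧ a ∈ maximizers f z} := by
  ext z
  constructor
  · intro hz
    have hz' := hz (f a) rfl
    exact ⟨mem_orthant_of_bounded (apply_mem_lowerHull f a) hz',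
      fun a' => hz' _ (apply_mem_lowerHull f a')⟩
  · rintro ⟨hz, ha⟩ x rfl x' hx'
    exact dotProduct_le_of_mem_lowerHull hz ha hx'

/-- The face extends downwards exactly along coordinates where `y` vanishes, whence the support
condition. Elsewhere its points agree with convex combinations of maximizers. -/
theorem normalCone_lowerHull_face [Nonempty α] (f : α → ι → ℝ) {y : ι → ℝ} (hy : y ∈ orthant ι) :
    normalCone (lowerHull f) {x ∈ lowerHull f | ∀ x' ∈ lowerHull f, y ⬝ᵥ x' ≤ y ⬝ᵥ x} =
      {z | z ∈ orthant ι ∧ (∀ b, y b = 0 → z b = 0) ∧ maximizers f y ⊆ maximizers f z} := by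
  classical
  obtain ⟨a₀, ha₀⟩ := maximizers_nonempty f y
  have hface : ∀ a ∈ maximizers f y,
      f a ∈ {x ∈ lowerHull f | ∀ x' ∈ lowerHull f, y ⬝ᵥ x' ≤ y ⬝ᵥ x} := fun a ha =>
    ⟨apply_mem_lowerHull f a, fun x' hx' => dotProduct_le_of_mem_lowerHull hy ha hx'⟩
  ext z
  constructor
  · intro hz
    have hzo : z ∈ orthant ι :=
      mem_orthant_of_bounded (apply_mem_lowerHull f a₀) (hz _ (hface a₀ ha₀))
    refine ⟨hzo, fun b hb => ?_, fun a ha a' => hz _ (hface a ha) _ (apply_mem_lowerHull f a')⟩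
    have h1 : f a₀ - Pi.single b 1 ∈
        {x ∈ lowerHull f | ∀ x' ∈ lowerHull f, y ⬝ᵥ x' ≤ y ⬝ᵥ x} := by
      refine ⟨mem_lowerHull_of_le (apply_mem_lowerHull f a₀) fun j => ?_, fun x' hx' => ?_⟩
      · by_cases h : j = b
        · subst h; simp
        · simp [h]
      · simpa [dotProduct_sub, hb] using (hface a₀ ha₀).2 x' hx'
    have h2 := hz _ h1 _ (apply_mem_lowerHull f a₀)
    simp only [dotProduct_sub, dotProduct_single, mul_one] at h2
    exact le_antisymm (by linarith) (hzo b)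
  · rintro ⟨hz, hsupp, hmax⟩ x ⟨⟨s, hs, hx⟩, hxmax⟩ x' hx'
    refine dotProduct_le_of_mem_lowerHull hz (fun a => (hmax ha₀ a).trans ?_) hx'
    have hM : y ⬝ᵥ f a₀ ≤ y ⬝ᵥ x := hxmax _ (apply_mem_lowerHull f a₀)
    have hle : ∀ b ∈ Finset.univ, y b * x b ≤ y b * ∑ a, s a * f a b := fun b _ =>
      mul_le_mul_of_nonneg_left (hx b) (hy b)
    have hle' : ∀ a ∈ Finset.univ, s a * (y ⬝ᵥ f a) ≤ s a * (y ⬝ᵥ f a₀) := fun a _ =>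
      mul_le_mul_of_nonneg_left (ha₀ a) (hs.1 a)
    have e1 : y ⬝ᵥ x ≤ y ⬝ᵥ fun b => ∑ a, s a * f a b := Finset.sum_le_sum hle
    have e2 : ∑ a, s a * (y ⬝ᵥ f a) ≤ ∑ a, s a * (y ⬝ᵥ f a₀) := Finset.sum_le_sum hle'
    have e3 : ∑ a, s a * (y ⬝ᵥ f a₀) = y ⬝ᵥ f a₀ := by rw [← Finset.sum_mul, hs.2, one_mul]
    rw [dotProduct_sum_mul] at e1
    -- The chain of inequalities starts and ends at the maximum, so it is tight term by term.
    have q1 := (Finset.sum_eq_sum_iff_of_le hle).1 (by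
      change y ⬝ᵥ x = y ⬝ᵥ fun b => ∑ a, s a * f a b
      rw [dotProduct_sum_mul]; linarith)
    have q2 := (Finset.sum_eq_sum_iff_of_le hle').1 (by linarith)
    have r1 : z ⬝ᵥ x = z ⬝ᵥ fun b => ∑ a, s a * f a b := by
      refine Finset.sum_congr rfl fun b hb => ?_
      by_cases hyb : y b = 0
      · simp [hsupp b hyb]
      · rw [mul_left_cancel₀ hyb (q1 b hb)]
    have r2 : ∑ a, s a * (z ⬝ᵥ f a) = ∑ a, s a * (z ⬝ᵥ f a₀) := by
      refine Finset.sum_congr rfl fun a ha => ?_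
      by_cases hsa : s a = 0
      · simp [hsa]
      · have hya : y ⬝ᵥ f a = y ⬝ᵥ f a₀ := mul_left_cancel₀ hsa (q2 a ha)
        have ham : a ∈ maximizers f y := fun a' => (ha₀ a').trans hya.ge
        rw [le_antisymm (hmax ha₀ a) (hmax ham a₀)]
    rw [r1, dotProduct_sum_mul, r2, ← Finset.sum_mul, hs.2, one_mul]

theorem normalFan_lowerHull [Nonempty α] (f : α → ι → ℝ) :
    normalFan (lowerHull f) = {N | ∃ y ∈ orthant ι, N =
      {z | z ∈ orthant ι ∧ (∀ b, y b = 0 → z b = 0) ∧ maximizers f y ⊆ maximizers f z}} := by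
  ext N
  constructor
  · rintro ⟨F, hF, hne, rfl⟩
    obtain ⟨y, rfl⟩ := (isExposed_iff_dotProduct hne).1 hF
    obtain ⟨x, hx, hxm⟩ := hne
    have hy : y ∈ orthant ι := mem_orthant_of_bounded hx hxm
    exact ⟨y, hy, normalCone_lowerHull_face f hy⟩
  · rintro ⟨y, hy, rfl⟩
    obtain ⟨a, ha⟩ := maximizers_nonempty f y
    have hne : {x ∈ lowerHull f | ∀ x' ∈ lowerHull f, y ⬝ᵥ x' ≤ y ⬝ᵥ x}.Nonempty :=
      ⟨f a, apply_mem_lowerHull f a, fun x' hx' => dotProduct_le_of_mem_lowerHull hy ha hx'⟩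
    exact ⟨_, (isExposed_iff_dotProduct hne).2 ⟨y, rfl⟩, hne, (normalCone_lowerHull_face f hy).symm⟩

theorem normalFan_lowerHull_congr [Nonempty α] {f g : α → ι → ℝ}
    (h : ∀ y ∈ orthant ι, maximizers f y = maximizers g y) :
    normalFan (lowerHull f) = normalFan (lowerHull g) := by
  rw [normalFan_lowerHull, normalFan_lowerHull]
  have key : ∀ y ∈ orthant ι,
      {z | z ∈ orthant ι ∧ (∀ b, y b = 0 → z b = 0) ∧ maximizers f y ⊆ maximizers f z} =
      {z | z ∈ orthant ι ∧ (∀ b, y b = 0 → z b = 0) ∧ maximizers g y ⊆ maximizers g z} := by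
    intro y hy
    ext z
    refine and_congr_right fun hz => ?_
    rw [h y hy, h z hz]
  ext N
  exact exists_congr fun y => and_congr_right fun hy => by rw [key y hy]

end NormalFan

/-! ### Extreme points and their labels -/

section ExtremePoints

variable {α : Type*} {ι : Type w} [Fintype ι]

/-- Extreme points of polyhedra are exposed. -/
theorem IsPolyhedron.exists_unique_max {P : Set (ι → ℝ)} (hP : IsPolyhedron P) {x : ι → ℝ}
    (hx : x ∈ P.extremePoints ℝ) :
    ∃ y : ι → ℝ, ∀ x' ∈ P, y ⬝ᵥ x' ≤ y ⬝ᵥ x ∧ (y ⬝ᵥ x ≤ y ⬝ᵥ x' → x' = x) := by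
  classical
  obtain ⟨m, c, h, rfl⟩ := hP
  have hxP : ∀ k, c k ⬝ᵥ x ≤ h k := hx.1
  let I : Finset (Fin m) := Finset.univ.filter fun k => c k ⬝ᵥ x = h k
  -- The sum of the constraints active at `x`. If `x'` ties, all of them are constant on the line
  -- through `x'` and `x`, so the segment extends beyond `x` inside the polyhedron and extremality
  -- gives `x' = x`.
  refine ⟨∑ k ∈ I, c k, fun x' hx' => ?_⟩
  have hx'P : ∀ k, c k ⬝ᵥ x' ≤ h k := hx'
  have hI : ∀ k ∈ I, c k ⬝ᵥ x' ≤ c k ⬝ᵥ x := fun k hk =>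
    (hx'P k).trans (Finset.mem_filter.1 hk).2.ge
  simp only [sum_dotProduct]
  refine ⟨Finset.sum_le_sum hI, fun hge => ?_⟩
  have heq := (Finset.sum_eq_sum_iff_of_le hI).1 (le_antisymm (Finset.sum_le_sum hI) hge)
  have hev : ∀ᶠ t : ℝ in nhdsWithin 0 (Set.Ioi 0), ∀ k, c k ⬝ᵥ (x + t • (x - x')) ≤ h k := by
    rw [Filter.eventually_all]
    intro k
    simp only [dotProduct_add, dotProduct_smul, dotProduct_sub, smul_eq_mul]
    by_cases hk : c k ⬝ᵥ x = h k
    · refine Filter.Eventually.of_forall fun t => ?_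
      rw [heq k (Finset.mem_filter.2 ⟨Finset.mem_univ k, hk⟩)]
      simp [hk]
    · have hlim : Filter.Tendsto (fun t : ℝ => c k ⬝ᵥ x + t * (c k ⬝ᵥ x - c k ⬝ᵥ x'))
          (nhdsWithin 0 (Set.Ioi 0)) (nhds (c k ⬝ᵥ x)) := by
        have : Continuous fun t : ℝ => c k ⬝ᵥ x + t * (c k ⬝ᵥ x - c k ⬝ᵥ x') := by fun_prop
        simpa using (this.tendsto 0).mono_left nhdsWithin_le_nhds
      exact hlim.eventually_le_const (lt_of_le_of_ne (hxP k) hk)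
  obtain ⟨t, ht, htpos⟩ := (hev.and self_mem_nhdsWithin).exists
  have htpos : 0 < t := htpos
  refine (mem_extremePoints_iff_left.1 hx).2 x' hx' (x + t • (x - x')) ht
    ⟨t / (1 + t), 1 / (1 + t), by positivity, by positivity, by field_simp; ring, ?_⟩
  ext b
  simp only [Pi.add_apply, Pi.smul_apply, Pi.sub_apply, smul_eq_mul]
  field_simp
  ring

/-- A subset of `P` whose normal cone has nonempty interior has at most one point. -/
theorem subsingleton_of_eventually_mem_normalCone {P F : Set (ι → ℝ)} {y : ι → ℝ} (hF : F ⊆ P)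
    (h : ∀ᶠ z in nhds y, z ∈ normalCone P F) : F.Subsingleton := by
  intro x hx x' hx'
  have hlim : Filter.Tendsto (fun t : ℝ => y + t • (x - x')) (nhdsWithin 0 (Set.Ioi 0))
      (nhds y) := by
    have : Continuous fun t : ℝ => y + t • (x - x') := by fun_prop
    simpa using (this.tendsto 0).mono_left nhdsWithin_le_nhds
  obtain ⟨t, ht, htpos⟩ := ((hlim.eventually h).and self_mem_nhdsWithin).exists
  have htpos : 0 < t := htpos
  have h₁ := ht x' hx' x (hF hx)
  have h₂ := h.self_of_nhds x hx x' (hF hx')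
  have h₃ : (x - x') ⬝ᵥ (x - x') ≤ 0 := by
    simp only [add_dotProduct, smul_dotProduct, smul_eq_mul] at h₁
    rw [dotProduct_sub]
    nlinarith
  have h₄ : 0 ≤ (x - x') ⬝ᵥ (x - x') := Finset.sum_nonneg fun b _ => mul_self_nonneg _
  exact sub_eq_zero.1 (dotProduct_self_eq_zero.1 (le_antisymm h₃ h₄))

theorem maximizers_eq_singleton {f : α → ι → ℝ} {a : α} {y : ι → ℝ}
    (h : ∀ a', a' ≠ a → y ⬝ᵥ f a' < y ⬝ᵥ f a) : maximizers f y = {a} := by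
  ext a₁
  refine ⟨fun h₁ => by_contra fun e => (h a₁ e).not_ge (h₁ a), ?_⟩
  rintro rfl a'
  by_cases e : a' = a₁
  · rw [e]
  · exact (h a' e).le

variable [Fintype α]

/-- The normal cone of an undominated point has an interior point at which no other index is a
maximizer. -/
theorem exists_eventually_mem_normalCone {f : α → ι → ℝ} {a : α} (ha : ¬ IsDominatedIndex f a) :
    ∃ y : ι → ℝ, (∀ b, 0 < y b) ∧ maximizers f y = {a} ∧
      ∀ᶠ z in nhds y, z ∈ normalCone (lowerHull f) {f a} := by
  obtain ⟨y, hy, h⟩ := exists_pos_lt ha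
  refine ⟨y, hy, maximizers_eq_singleton h, ?_⟩
  rw [normalCone_lowerHull_singleton]
  have hpos : ∀ᶠ z in nhds y, ∀ b, (0 : ℝ) < z b := by
    rw [Filter.eventually_all]
    exact fun b => (continuous_apply b).continuousAt.eventually_const_lt (hy b)
  filter_upwards [hpos, eventually_lt_of_lt h] with z hz hlt
  exact ⟨fun b => (hz b).le, by rw [maximizers_eq_singleton hlt]; rfl⟩

/-- At a positive `y` whose only maximizer is `a`, the exposed face has a normal cone containing
that of `f a`, a neighborhood of `y`; so the face is a point. -/
theorem isExposed_lowerHull_singleton {f : α → ι → ℝ} {a : α} (ha : ¬ IsDominatedIndex f a) :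
    IsExposed ℝ (lowerHull f) {f a} := by
  obtain ⟨y, hy, hmax, hev⟩ := exists_eventually_mem_normalCone ha
  have hyo : y ∈ orthant ι := fun b => (hy b).le
  have : Nonempty α := ⟨a⟩
  have hmem : f a ∈ {x ∈ lowerHull f | ∀ x' ∈ lowerHull f, y ⬝ᵥ x' ≤ y ⬝ᵥ x} :=
    ⟨apply_mem_lowerHull f a, fun x' hx' =>
      dotProduct_le_of_mem_lowerHull hyo (hmax ▸ Set.mem_singleton a : a ∈ maximizers f y) hx'⟩
  have hsub : {x ∈ lowerHull f | ∀ x' ∈ lowerHull f, y ⬝ᵥ x' ≤ y ⬝ᵥ x}.Subsingleton := by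
    refine subsingleton_of_eventually_mem_normalCone (fun x hx => hx.1) (hev.mono fun z hz => ?_)
    rw [normalCone_lowerHull_singleton] at hz
    rw [normalCone_lowerHull_face f hyo]
    refine ⟨hz.1, fun b hb => ((hy b).ne' hb).elim, ?_⟩
    rw [hmax]
    exact Set.singleton_subset_iff.2 hz.2
  rw [isExposed_iff_dotProduct (Set.singleton_nonempty _)]
  exact ⟨y, (hsub.eq_singleton_of_mem hmem).symm⟩

theorem injective_normalCone_singleton {f : α → ι → ℝ} (hf : ∀ a, ¬ IsDominatedIndex f a) :
    Function.Injective fun a => normalCone (lowerHull f) {f a} := by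
  intro a a' h
  obtain ⟨y, hy, hmax, hev⟩ := exists_eventually_mem_normalCone (hf a)
  have hmem : y ∈ normalCone (lowerHull f) {f a'} :=
    (Set.ext_iff.1 h y).1 hev.self_of_nhds
  rw [normalCone_lowerHull_singleton, Set.mem_ofPred_eq, hmax] at hmem
  exact hmem.2.symm

theorem bijOn_extremePoints_lowerHull {f : α → ι → ℝ} (hf : ∀ a, ¬ IsDominatedIndex f a) :
    Set.BijOn f Set.univ ((lowerHull f).extremePoints ℝ) := by
  refine ⟨fun a _ => (isExposed_lowerHull_singleton (hf a)).isExtreme.mem_extremePoints,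
    fun a _ a' _ h => injective_normalCone_singleton hf (by simp only [h]), fun x hx => ?_⟩
  obtain ⟨y, hy⟩ := (isPolyhedron_lowerHull f).exists_unique_max hx
  have hyo : y ∈ orthant ι := mem_orthant_of_bounded hx.1 fun z hz => (hy z hz).1
  have : Nonempty α := by
    obtain ⟨s, hs, -⟩ := hx.1
    by_contra hE
    rw [not_nonempty_iff] at hE
    simpa using hs.2
  obtain ⟨a, ha⟩ := maximizers_nonempty f y
  exact ⟨a, trivial, (hy _ (apply_mem_lowerHull f a)).2
    (dotProduct_le_of_mem_lowerHull hyo ha hx.1)⟩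

theorem exists_labeling [Nonempty α] {f : α → ι → ℝ} (hf : ∀ a, ¬ IsDominatedIndex f a)
    {Q : Set (ι → ℝ)} (hQ : IsPolyhedron Q) (hfan : normalFan Q = normalFan (lowerHull f)) :
    ∃ g : α → ι → ℝ, Set.BijOn g Set.univ (Q.extremePoints ℝ) ∧
      ∀ a, normalCone Q {g a} = normalCone (lowerHull f) {f a} := by
  have hex : ∀ a, ∃ x, IsExposed ℝ Q {x} ∧
      normalCone Q {x} = normalCone (lowerHull f) {f a} := by
    intro a
    have hmem : normalCone (lowerHull f) {f a} ∈ normalFan Q := by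
      rw [hfan]
      exact ⟨_, isExposed_lowerHull_singleton (hf a), Set.singleton_nonempty _, rfl⟩
    obtain ⟨F, hF, ⟨x, hx⟩, hN⟩ := hmem
    obtain ⟨y, -, -, hev⟩ := exists_eventually_mem_normalCone (hf a)
    rw [hN] at hev
    obtain rfl := (subsingleton_of_eventually_mem_normalCone hF.subset hev).eq_singleton_of_mem hx
    exact ⟨x, hF, hN.symm⟩
  choose g hg hN using hex
  refine ⟨g, ⟨fun a _ => (hg a).isExtreme.mem_extremePoints, fun a _ a' _ h => ?_,
    fun x hx => ?_⟩, hN⟩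
  · refine injective_normalCone_singleton hf ?_
    simp only [← hN, h]
  · obtain ⟨y, hy⟩ := hQ.exists_unique_max hx
    have hsing : {x} = {x ∈ Q | ∀ x' ∈ Q, y ⬝ᵥ x' ≤ y ⬝ᵥ x} := by
      ext x₁
      constructor
      · rintro rfl
        exact ⟨hx.1, fun x' hx' => (hy x' hx').1⟩
      · exact fun h => (hy x₁ h.1).2 (h.2 x hx.1)
    have hmem : normalCone Q {x} ∈ normalFan (lowerHull f) := by
      rw [← hfan]
      exact ⟨_, (isExposed_iff_dotProduct (Set.singleton_nonempty _)).2 ⟨y, hsing⟩,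
        Set.singleton_nonempty _, rfl⟩
    have hyx : y ∈ normalCone Q {x} := by
      rintro _ rfl x' hx'
      exact (hy x' hx').1
    rw [normalFan_lowerHull] at hmem
    obtain ⟨y', -, hy'⟩ := hmem
    rw [hy'] at hyx
    obtain ⟨a, ha⟩ := maximizers_nonempty f y
    -- Equality of fans puts `y` in the orthant, so some `f`-maximizer `a` exists there; then `g a`
    -- maximizes `y` over `Q`, where `x` is the only maximizer.
    have hya : y ∈ normalCone Q {g a} := by
      rw [hN, normalCone_lowerHull_singleton]
      exact ⟨hyx.1, ha⟩
    exact ⟨a, trivial, (hy _ ((hg a).subset rfl)).2 (hya _ rfl _ hx.1)⟩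

theorem labeling_unique {f g g' : α → ι → ℝ} (hf : ∀ a, ¬ IsDominatedIndex f a) {Q : Set (ι → ℝ)}
    (hg : Set.BijOn g Set.univ (Q.extremePoints ℝ))
    (hN : ∀ a, normalCone Q {g a} = normalCone (lowerHull f) {f a})
    (hg' : Set.BijOn g' Set.univ (Q.extremePoints ℝ))
    (hN' : ∀ a, normalCone Q {g' a} = normalCone (lowerHull f) {f a}) : g = g' := by
  funext a
  obtain ⟨a', -, h⟩ := hg'.surjOn (hg.mapsTo (Set.mem_univ a))
  have : a' = a := injective_normalCone_singleton hf (by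
    beta_reduce
    rw [← hN', ← hN, h])
  rw [← h, this]

theorem maximizers_eq_of_labeling [Nonempty α] {f g : α → ι → ℝ} {Q : Set (ι → ℝ)}
    (hg : ∀ a, g a ∈ Q) (hN : ∀ a, normalCone Q {g a} = normalCone (lowerHull f) {f a})
    {y : ι → ℝ} (hy : y ∈ orthant ι) : maximizers f y = maximizers g y := by
  have hcone : ∀ a, a ∈ maximizers f y ↔ y ∈ normalCone Q {g a} := fun a => by
    rw [hN, normalCone_lowerHull_singleton]
    exact ⟨fun h => ⟨hy, h⟩, fun h => h.2⟩
  ext a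
  rw [hcone]
  constructor
  · exact fun h a' => h _ rfl _ (hg a')
  · rintro h _ rfl x' hx'
    -- Some `g a₀` attains the maximum over all of `Q`, so being best among the `g a'` suffices.
    obtain ⟨a₀, ha₀⟩ := maximizers_nonempty f y
    exact ((hcone a₀).1 ha₀ _ rfl x' hx').trans (h a₀)

end ExtremePoints

/-! ### From games to polyhedra -/

section Games

variable {n : ℕ} {A : Fin n → Type w}

theorem profile_apply_self (i : Fin n) (a : A i) (b : Opp A i) : profile i a b i = a := by
  simp [profile]

theorem profile_apply_ne (i : Fin n) (a : A i) (b : Opp A i) (j : {j : Fin n // j ≠ i}) :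
    profile i a b j = b j := by
  simp [profile, j.2]

/-- The game in which agent `i` has the utility vectors `g i`. -/
def utilitiesOfVectors (g : ∀ i, A i → Opp A i → ℝ) : Utilities A :=
  fun i p => g i (p i) fun j => p j

theorem utilityVector_utilitiesOfVectors (g : ∀ i, A i → Opp A i → ℝ) (i : Fin n) :
    utilityVector (utilitiesOfVectors g) i = g i := by
  funext a b
  simp only [utilityVector, slice, utilitiesOfVectors, profile_apply_self, profile_apply_ne]

theorem utilitiesOfVectors_utilityVector (u : Utilities A) :
    utilitiesOfVectors (utilityVector u) = u := by
  funext i p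
  have : profile i (p i) (fun j => p j) = p := (Equiv.piSplitAt i A).symm_apply_apply p
  simp only [utilitiesOfVectors, utilityVector, slice, this]

variable [∀ i, Fintype (A i)]

theorem exists_slice_eq_smul (i : Fin n) (a : A i) {y : Opp A i → ℝ}
    (hy : y ∈ orthant (Opp A i)) (hy0 : y ≠ 0) :
    ∃ x ∈ stdSimplex ℝ (∀ j, A j), ∃ t : ℝ, 0 < t ∧ slice x i a = t • y := by
  classical
  have hsum : 0 < ∑ b, y b := by
    obtain ⟨b, hb⟩ := Function.ne_iff.1 hy0
    exact Finset.sum_pos' (fun b _ => hy b)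
      ⟨b, Finset.mem_univ b, lt_of_le_of_ne (hy b) (Ne.symm hb)⟩
  have ht : 0 < (∑ b, y b)⁻¹ := inv_pos.2 hsum
  -- All mass sits on profiles where agent `i` is recommended `a`.
  let x : (∀ j, A j) → ℝ := fun p => if p i = a then (∑ b, y b)⁻¹ * y (fun j => p j) else 0
  have hx : ∀ a' b, x (profile i a' b) = if a' = a then (∑ b, y b)⁻¹ * y b else 0 := by
    intro a' b
    simp only [x, profile_apply_self, profile_apply_ne]
  refine ⟨x, ⟨fun p => ?_, ?_⟩, _, ht, ?_⟩
  · dsimp only [x]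
    split_ifs
    exacts [mul_nonneg ht.le (hy _), le_rfl]
  · rw [← (Equiv.piSplitAt i A).symm.sum_comp, Fintype.sum_prod_type]
    have : ∀ a' b, x ((Equiv.piSplitAt i A).symm (a', b)) =
        if a' = a then (∑ b, y b)⁻¹ * y b else 0 := hx
    simp only [this]
    rw [Finset.sum_eq_single a]
    · simp only [if_true, ← Finset.mul_sum]
      exact inv_mul_cancel₀ hsum.ne'
    · intro a' _ ha'
      simp [ha']
    · simp
  · funext b
    simp [slice, hx]

theorem brIndistinguishable_iff (u v : Utilities A) [∀ i, Nonempty (A i)] :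
    BRIndistinguishable u v ↔ ∀ i, ∀ y ∈ orthant (Opp A i),
      maximizers (utilityVector u i) y = maximizers (utilityVector v i) y := by
  constructor
  · intro h i y hy
    by_cases hy0 : y = 0
    · rw [hy0, maximizers_zero, maximizers_zero]
    · obtain ⟨a⟩ := ‹∀ i, Nonempty (A i)› i
      obtain ⟨x, hx, t, ht, hs⟩ := exists_slice_eq_smul i a hy hy0
      have := h x hx i a
      change maximizers _ (slice x i a) = maximizers _ (slice x i a) at this
      rwa [hs, maximizers_smul _ _ ht, maximizers_smul _ _ ht] at this
  · exact fun h x hx i a => h i _ fun b => hx.1 _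

theorem polarizedPolyhedron_eq_lowerHull (u : Utilities A) (i : Fin n) :
    polarizedPolyhedron u i = lowerHull (utilityVector u i) := by
  classical
  have hpolar : polarCone (orthant (Opp A i)) = {k | ∀ b, k b ≤ 0} := by
    ext k
    constructor
    · intro hk b
      simpa using hk (Pi.single b 1) (fun j => by
        by_cases h : j = b
        · subst h; simp
        · simp [h])
    · exact fun hk y hy => Finset.sum_nonpos fun b _ =>
        mul_nonpos_of_nonneg_of_nonpos (hy b) (hk b)
  have hhull : utilityPolytope u i =
      {z | ∃ s ∈ stdSimplex ℝ (A i), z = fun b => ∑ a, s a * utilityVector u i a b} := by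
    have hL : Set.range (utilityVector u i) = Fintype.linearCombination ℝ (utilityVector u i) ''
        Set.range (fun a : A i => (Pi.single a 1 : A i → ℝ)) := by
      rw [← Set.range_comp]
      congr 1
      funext a
      simp
    rw [utilityPolytope, hL, ← LinearMap.image_convexHull, convexHull_rangle_single_eq_stdSimplex]
    ext z
    refine exists_congr fun s => and_congr_right fun _ => ?_
    rw [eq_comm, Fintype.linearCombination_apply]
    refine Eq.congr_right (funext fun b => ?_)
    simp [Finset.sum_apply]
  ext z
  rw [polarizedPolyhedron, Set.mem_add, hpolar, hhull]
  constructor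
  · rintro ⟨p, ⟨s, hs, rfl⟩, k, hk, rfl⟩
    exact ⟨s, hs, fun b => by simpa using hk b⟩
  · rintro ⟨s, hs, h⟩
    exact ⟨_, ⟨s, hs, rfl⟩, z - fun b => ∑ a, s a * utilityVector u i a b,
      fun b => by simpa using h b, by simp⟩

theorem noDominatedActions_of_brIndistinguishable [∀ i, Nonempty (A i)] {u v : Utilities A}
    (hu : NoDominatedActions u) (h : BRIndistinguishable u v) : NoDominatedActions v := by
  intro i a
  obtain ⟨y, hy, hmax, -⟩ := exists_eventually_mem_normalCone (hu i a)
  have hyo : y ∈ orthant (Opp A i) := fun b => (hy b).le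
  rw [(brIndistinguishable_iff u v).1 h i y hyo] at hmax
  have ha : a ∈ maximizers (utilityVector v i) y := hmax ▸ Set.mem_singleton a
  refine not_isDominatedIndex_of_lt hyo fun a' ha' => lt_of_not_ge fun hge => ha' ?_
  have : a' ∈ maximizers (utilityVector v i) y := fun a'' => (ha a'').trans hge
  rwa [hmax] at this

end Games

end NormalFormGame

open NormalFormGame in
theorem theorem3 {n : ℕ} {A : Fin n → Type*} [∀ i, Fintype (A i)] [∀ i, Nonempty (A i)]
    (u : Utilities A) (hu : NoDominatedActions u) :
    brIndistinguishabilitySet u =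
        {v | ∃ Q : ∀ i, Set (Opp A i → ℝ),
          NormallyEquivalent u Q ∧ IsLabeledExtremePoints u Q v} ∧
      (∀ Q : ∀ i, Set (Opp A i → ℝ), NormallyEquivalent u Q →
        ∃! v : Utilities A, IsLabeledExtremePoints u Q v) ∧
      ∀ v : Utilities A, BRIndistinguishable u v → NoDominatedActions v := by
  refine ⟨?_, fun Q hQ => ?_, fun v => noDominatedActions_of_brIndistinguishable hu⟩
  · ext v
    constructor
    · rintro ⟨hv, huv⟩
      have hmax := (brIndistinguishable_iff u v).1 huv
      -- The polarized polyhedra of `v` itself realize `v`.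
      refine ⟨fun i => lowerHull (utilityVector v i), fun i => ⟨isPolyhedron_lowerHull _, ?_⟩,
        fun i => ⟨bijOn_extremePoints_lowerHull (hv i), fun a => ?_⟩⟩
      · rw [polarizedPolyhedron_eq_lowerHull]
        exact (normalFan_lowerHull_congr (hmax i)).symm
      · rw [polarizedPolyhedron_eq_lowerHull, normalCone_lowerHull_singleton,
          normalCone_lowerHull_singleton]
        ext z
        exact and_congr_right fun hz => by rw [hmax i z hz]
    · rintro ⟨Q, -, hv⟩
      have huv : BRIndistinguishable u v := (brIndistinguishable_iff u v).2 fun i y hy =>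
        maximizers_eq_of_labeling (Q := Q i) (fun a => ((hv i).1.mapsTo (Set.mem_univ a)).1)
          (fun a => by rw [(hv i).2 a, polarizedPolyhedron_eq_lowerHull]) hy
      exact ⟨noDominatedActions_of_brIndistinguishable hu huv, huv⟩
  · have hex : ∀ i, ∃ g : A i → Opp A i → ℝ, Set.BijOn g Set.univ ((Q i).extremePoints ℝ) ∧
        ∀ a, normalCone (Q i) {g a} = normalCone (lowerHull (utilityVector u i))
          {utilityVector u i a} := fun i =>
      exists_labeling (hu i) (hQ i).1 (by rw [(hQ i).2, polarizedPolyhedron_eq_lowerHull])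
    choose g hg hN using hex
    refine ⟨utilitiesOfVectors g, fun i => ?_, fun v hv => ?_⟩
    · rw [utilityVector_utilitiesOfVectors, polarizedPolyhedron_eq_lowerHull]
      exact ⟨hg i, hN i⟩
    · rw [← utilitiesOfVectors_utilityVector v]
      congr 1
      funext i
      refine labeling_unique (hu i) (hv i).1 (fun a => ?_) (hg i) (hN i)
      rw [(hv i).2 a, polarizedPolyhedron_eq_lowerHull]
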